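/- A finite nonzero ring $R$ is called a Carmichael ring if it is not a field and $a^{|R|}=a$ for all $a\in R$; an element $a$ of a commutative ring $A$ is called Carmichael if $A/aA$ is a Carmichael ring. For a finite extension $K$ of $\mathbb{F}_q(t)$ let $\mathcal{O}_K$ be the integral closure of $\mathbb{F}_q[t]$ in $K$, let the discriminant of $K$ be the discriminant ideal of $\mathcal{O}_K$ over $\mathbb{F}_q[t]$, and say that $g\in\mathbb{F}_q[t]$ is Carmichael in $K$ if it is a Carmichael element of $\mathcal{O}_K$. **Theorem.** Let $g\in\mathbb{F}_q[t]$ be a square-free polynomial that is not a Carmichael element of $\mathbb{F}_q[t]$, and let $\ell$ be a prime factor of $q-1$. Then there are infinitely many cyclic extensions $K/\mathbb{F}_q(t)$ of degree $\ell$ (inside a fixed algebraic closure of $\mathbb{F}_q(t)$), each of the form $K=\mathbb{F}_q(t)(\sqrt[\ell]{Q})$ with $Q\in\mathbb{F}_q[t]$, whose discriminant is relatively prime to $g$ and in which $g$ is not Carmichael. Moreover, if $g$ is non-constant, then there is a monic irreducible factor $P$ of $g$, with $\deg P\nmid\deg g$ unless $g$ is itself irreducible, such that infinitely many of these extensions $K$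 have the additional property that $P$ is inert in $K$, that is, $P\mathcal{O}_K$ is a prime ideal. -/

import Mathlib

open Polynomial

/-- A Carmichael ring: a finite nonzero ring that is not a field and in which every element
satisfies `a ^ |R| = a`. -/
def IsCarmichaelRing (R : Type*) [Ring R] : Prop :=
  Finite R ∧ Nontrivial R ∧ ¬ IsField R ∧ ∀ a : R, a ^ Nat.card R = a

/-- An ideal is Carmichael if the quotient by it is a Carmichael ring. -/
def IsCarmichaelIdeal {R : Type*} [CommRing R] (I : Ideal R) : Prop :=
  IsCarmichaelRing (R ⧸ I)

/-- An element is Carmichael if it generates a Carmichael ideal. -/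
def IsCarmichaelElement {R : Type*} [CommRing R] (a : R) : Prop :=
  IsCarmichaelIdeal (Ideal.span {a})

/-- A polynomial `g` over `F` is Carmichael in the function field `K` if its image is a Carmichael
element of the integral closure of `F[t]` in `K`. -/
def IsCarmichaelIn {F : Type*} [Field F] (K : Type*) [Field K] [Algebra F[X] K]
    (g : F[X]) : Prop :=
  IsCarmichaelElement (algebraMap F[X] (FunctionField.ringOfIntegers F K) g)

/-- A polynomial `P` over `F` is inert in the function field `K` if it generates a prime ideal
in the integral closure of `F[t]` in `K` (used for irreducible `P`). -/
def IsInertIn {F : Type*} [Field F] (K : Type*) [Field K] [Algebra F[X] K] (P : F[X]) : Prop :=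
  (Ideal.span {algebraMap F[X] (FunctionField.ringOfIntegers F K) P}).IsPrime

/-- The discriminant of a finite extension `K / F(t)` with respect to `F[t]`: the ideal of `F[t]`
generated by the discriminants of all `F(t)`-bases of `K` that consist of elements integral
over `F[t]`. -/
noncomputable def discriminantIdeal (F : Type*) [Field F] (K : Type*) [Field K] [Algebra F[X] K]
    [Algebra (RatFunc F) K] : Ideal F[X] :=
  Ideal.span {d : F[X] | ∃ b : Module.Basis (Fin (Module.finrank (RatFunc F) K)) (RatFunc F) K,
    (∀ i, IsIntegral F[X] (b i)) ∧
      algebraMap F[X] (RatFunc F) d = Algebra.discr (RatFunc F) b}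

/-- `K` is a cyclic Galois extension of `k` of degree `n`. -/
def IsCyclicExtensionOfDegree (k K : Type*) [Field k] [Field K] [Algebra k K] (n : ℕ) : Prop :=
  IsGalois k K ∧ IsCyclic (K ≃ₐ[k] K) ∧ Module.finrank k K = n

/-- The subfield `K` of the algebraic closure of `F(t)` is a Kummer extension of the form
`F(t)(Q ^ (1 / n))` with `Q` a polynomial. -/
def IsAdjoinRootOfPolynomial {F : Type*} [Field F]
    (K : IntermediateField (RatFunc F) (AlgebraicClosure (RatFunc F))) (n : ℕ) : Prop :=
  ∃ (Q : F[X]) (α : AlgebraicClosure (RatFunc F)),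
    α ^ n = algebraMap F[X] (AlgebraicClosure (RatFunc F)) Q ∧
      K = IntermediateField.adjoin (RatFunc F) {α}

/-- The extensions of `F(t)`, as subfields of a fixed algebraic closure, that are cyclic of degree
`n`, of the form `F(t)(Q ^ (1 / n))`, with discriminant relatively prime to `g`, and in which
`g` is not Carmichael. -/
def nonCarmichaelKummerExtensions {F : Type*} [Field F] (g : F[X]) (n : ℕ) :
    Set (IntermediateField (RatFunc F) (AlgebraicClosure (RatFunc F))) :=
  {K | IsCyclicExtensionOfDegree (RatFunc F) K n ∧
    IsAdjoinRootOfPolynomial K n ∧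
    IsCoprime (discriminantIdeal F K) (Ideal.span {g}) ∧
    ¬ IsCarmichaelIn K g}

/-! Korselt's criterion governs both levels. A square-free `g` that is neither a unit nor
irreducible, and whose prime factors all have degree dividing `deg g`, is Carmichael. So a
non-Carmichael `g` is a unit, irreducible, or has a prime factor `P` with `deg P ∤ deg g`
(`exists_irreducible_dvd_not_natDegree_dvd`).

If `P` is inert in `K` of degree `ℓ`, both degrees are multiplied by `ℓ`: the residue field at `P`
has `q ^ (ℓ deg P)` elements and `O_K / g` has `q ^ (ℓ deg g)`, so the failure of divisibility
persists (`not_isCarmichaelIn_of_not_natDegree_dvd`). If `g` is irreducible, `O_K / g` is a field.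

It remains to find many `K`. Adjoining an `ℓ`-th root of `Q` makes `P` inert when `Q` is not an
`ℓ`-th power modulo `P`. Fix such a residue `c`, prime to `g`; for each prime `p` not dividing `cg`,
one of `p`, `pc` serves as `Q`. The discriminant ideal contains `± ℓ ^ ℓ Q ^ (ℓ - 1)`, prime to `g`,
and Kummer theory shows that distinct `p` give distinct fields (`injOn_adjoin_of_pow_eq`). -/

/-! ### Kummer theory in prime degree -/

open IntermediateField in
theorem isGalois_isCyclic_finrank_adjoin_of_pow_eq {k L : Type*} [Field k] [Field L]
    [Algebra k L] {n : ℕ} (hn : n.Prime) {ζ : k} (hζ : IsPrimitiveRoot ζ n) {a : k}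
    (ha : ∀ b : k, b ^ n ≠ a) {α : L} (hα : α ^ n = algebraMap k L a) :
    IsGalois k k⟮α⟯ ∧ IsCyclic (k⟮α⟯ ≃ₐ[k] k⟮α⟯) ∧ Module.finrank k k⟮α⟯ = n := by
  have : NeZero n := ⟨hn.ne_zero⟩
  have hirr := X_pow_sub_C_irreducible_of_prime hn ha
  have hint : IsIntegral k α :=
    ⟨X ^ n - C a, monic_X_pow_sub_C a hn.ne_zero, by simp [hα]⟩
  have hmin : minpoly k α = X ^ n - C a :=
    (minpoly.eq_of_irreducible_of_monic hirr (by simp [hα]) (monic_X_pow_sub_C a hn.ne_zero)).symm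
  have hfin : Module.finrank k k⟮α⟯ = n := by
    rw [adjoin.finrank hint, hmin, natDegree_X_pow_sub_C]
  have : FiniteDimensional k k⟮α⟯ := adjoin.finiteDimensional hint
  have hr : (primitiveRoots n k).Nonempty := ⟨ζ, by rwa [mem_primitiveRoots hn.pos]⟩
  have hsp : IsSplittingField k k⟮α⟯ (X ^ n - C a) := by
    have h := isSplittingField_X_pow_sub_C_of_root_adjoin_eq_top (K := k) (L := k⟮α⟯)
      (by rwa [hfin]) (a := a) (α := AdjoinSimple.gen k α)
      (by rw [hfin]; exact Subtype.ext (by simpa using hα))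
      (by
        apply IntermediateField.lift_injective
        rw [IntermediateField.lift_adjoin_simple, AdjoinSimple.coe_gen, IntermediateField.lift_top])
    rwa [hfin] at h
  exact ⟨isGalois_of_isSplittingField_X_pow_sub_C hr hirr _,
    isCyclic_of_isSplittingField_X_pow_sub_C hr hirr _, hfin⟩

open IntermediateField in
-- A generator `σ` of the Galois group multiplies `α` by a primitive root of unity `η` and `β` by
-- some `η ^ i`, so `β / α ^ i` is fixed and lies in `k`.
theorem exists_eq_pow_mul_pow_of_adjoin_eq {k L : Type*} [Field k] [Field L] [Algebra k L] {n : ℕ}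
    (hn : n.Prime) {ζ : k} (hζ : IsPrimitiveRoot ζ n) {a b : k} (ha : ∀ c : k, c ^ n ≠ a)
    {α β : L} (hα : α ^ n = algebraMap k L a) (hβ : β ^ n = algebraMap k L b)
    (hβα : β ∈ k⟮α⟯) : ∃ (i : ℕ) (r : k), b = a ^ i * r ^ n := by
  obtain ⟨hgal, -, hfin⟩ := isGalois_isCyclic_finrank_adjoin_of_pow_eq hn hζ ha hα
  have : NeZero n := ⟨hn.ne_zero⟩
  have : Fact n.Prime := ⟨hn⟩
  have : FiniteDimensional k k⟮α⟯ := .of_finrank_pos (hfin ▸ hn.pos)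
  set x : k⟮α⟯ := AdjoinSimple.gen k α
  set y : k⟮α⟯ := ⟨β, hβα⟩
  have hx : x ^ n = algebraMap k _ a := Subtype.ext (by simpa [x] using hα)
  have hy : y ^ n = algebraMap k _ b := Subtype.ext (by simpa [y] using hβ)
  have hx0 : x ≠ 0 := by
    intro h
    apply ha 0
    rw [h] at hx
    apply (algebraMap k k⟮α⟯).injective
    rw [← hx, map_pow, map_zero]
  obtain ⟨σ, hσ⟩ : ∃ σ : k⟮α⟯ ≃ₐ[k] k⟮α⟯, σ x ≠ x := by
    by_contra! h
    obtain ⟨c, hc⟩ := IntermediateField.mem_bot.1 ((IsGalois.mem_bot_iff_fixed x).2 h)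
    apply ha c
    apply (algebraMap k k⟮α⟯).injective
    rw [← hx, map_pow, hc]
  have hζ' := hζ.map_of_injective (algebraMap k k⟮α⟯).injective
  set η := σ x / x with hη
  have hη1 : η ^ n = 1 := by
    rw [hη, div_pow, ← map_pow, hx, AlgEquiv.commutes, div_self]
    rw [← hx]; exact pow_ne_zero _ hx0
  have hηne : η ≠ 1 := by
    rw [hη]; rwa [Ne, div_eq_one_iff_eq hx0]
  have hηp : IsPrimitiveRoot η n := by
    rw [← orderOf_eq_prime hη1 hηne]; exact IsPrimitiveRoot.orderOf η
  have hσx : σ x = η * x := by rw [hη, div_mul_cancel₀ _ hx0]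
  obtain ⟨i, hi⟩ : ∃ i : ℕ, σ y = η ^ i * y := by
    by_cases hy0 : y = 0
    · exact ⟨0, by simp [hy0]⟩
    obtain ⟨i, -, hi⟩ := hηp.eq_pow_of_pow_eq_one (ξ := σ y / y) (by
      rw [div_pow, ← map_pow, hy, AlgEquiv.commutes, div_self]
      rw [← hy]; exact pow_ne_zero _ hy0)
    exact ⟨i, by rw [hi, div_mul_cancel₀ _ hy0]⟩
  have hη0 : η ≠ 0 := hηp.ne_zero hn.ne_zero
  have hfix : σ (y / x ^ i) = y / x ^ i := by
    rw [map_div₀, map_pow, hσx, hi, mul_pow]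
    exact mul_div_mul_left _ _ (pow_ne_zero _ hη0)
  have hcard : Nat.card (k⟮α⟯ ≃ₐ[k] k⟮α⟯) = n := by rw [IsGalois.card_aut_eq_finrank, hfin]
  have htop : Subgroup.zpowers σ = ⊤ :=
    zpowers_eq_top_of_prime_card hcard (by rintro rfl; exact hσ rfl)
  obtain ⟨r, hr⟩ := IntermediateField.mem_bot.1
    ((IsGalois.mem_bot_iff_fixed (y / x ^ i)).2 fun τ ↦ by
      have hτ : τ ∈ Subgroup.zpowers σ := htop ▸ Subgroup.mem_top τ
      have hle : Subgroup.zpowers σ ≤ MulAction.stabilizer _ (y / x ^ i) := by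
        rw [Subgroup.zpowers_le]; exact hfix
      exact hle hτ)
  refine ⟨i, r, (algebraMap k k⟮α⟯).injective ?_⟩
  rw [map_mul, map_pow, map_pow, hr, ← hx, ← hy, div_pow, ← pow_mul, ← pow_mul, mul_comm i n,
    mul_div_cancel₀]
  exact pow_ne_zero _ hx0

/-! ### Polynomials over a field and their residue rings -/

theorem natCard_quotient_span_singleton {F : Type*} [Field F] {f : F[X]} (hf : f ≠ 0) :
    Nat.card (F[X] ⧸ Ideal.span {f}) = Nat.card F ^ f.natDegree := by
  have : Module.Finite F (F[X] ⧸ Ideal.span {f}) := (AdjoinRoot.powerBasis hf).finite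
  rw [Module.natCard_eq_pow_finrank (K := F), finrank_quotient_span_eq_natDegree]

theorem finite_quotient_span_singleton {F : Type*} [Field F] [Finite F] {f : F[X]} (hf : f ≠ 0) :
    Finite (F[X] ⧸ Ideal.span {f}) := by
  have : Module.Finite F (F[X] ⧸ Ideal.span {f}) := (AdjoinRoot.powerBasis hf).finite
  exact Module.finite_of_finite F

theorem exists_monic_irreducible_dvd {F : Type*} [Field F] {f : F[X]} (hf : ¬ IsUnit f)
    (h0 : f ≠ 0) : ∃ P : F[X], P.Monic ∧ Irreducible P ∧ P ∣ f := by
  obtain ⟨p, hp, hpf⟩ := WfDvdMonoid.exists_irreducible_factor hf h0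
  classical
  exact ⟨normalize p, monic_normalize hp.ne_zero,
    (associated_normalize p).irreducible hp, (normalize_associated p).dvd.trans hpf⟩

theorem infinite_setOf_monic_irreducible_not_dvd {F : Type*} [Field F] {f : F[X]} (hf : f ≠ 0) :
    {p : F[X] | p.Monic ∧ Irreducible p ∧ ¬ p ∣ f}.Infinite := by
  intro hfin
  set h : F[X] := f * ∏ p ∈ hfin.toFinset, p
  have hh : h ≠ 0 := mul_ne_zero hf (Finset.prod_ne_zero_iff.2 fun p hp ↦
    ((hfin.mem_toFinset.1 hp).2.1).ne_zero)
  -- Euclid's argument; the factor `X` keeps `X * h + 1` non-constant even when `h` is constant.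
  have hdeg : (X * h + 1).natDegree = h.natDegree + 1 := by
    rw [← C_1, natDegree_add_C, natDegree_X_mul hh]
  have hne : X * h + 1 ≠ 0 := by
    intro h0; rw [h0] at hdeg; simp at hdeg
  obtain ⟨p, hpm, hpi, hpd⟩ := exists_monic_irreducible_dvd (f := X * h + 1)
    (fun hu ↦ by rw [natDegree_eq_zero_of_isUnit hu] at hdeg; omega) hne
  have hph : ¬ p ∣ h := fun hd ↦
    hpi.not_isUnit (isUnit_of_dvd_one ((dvd_add_right (hd.mul_left X)).1 hpd))
  by_cases hpf : p ∣ f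
  · exact hph (hpf.mul_right _)
  · exact hph ((Finset.dvd_prod_of_mem _ (hfin.mem_toFinset.2 ⟨hpm, hpi, hpf⟩)).mul_left _)

/-- Otherwise `x ↦ x ^ (q ^ deg g)` is an iterate of the `q ^ deg p` power map, hence the identity,
on every residue field `F[X] / p` with `p ∣ g`. -/
theorem exists_irreducible_dvd_not_natDegree_dvd {F : Type*} [Field F] [Finite F] {g : F[X]}
    (hg : Squarefree g) (hgC : ¬ IsCarmichaelElement g) (hu : ¬ IsUnit g) (hirr : ¬ Irreducible g) :
    ∃ P : F[X], P.Monic ∧ Irreducible P ∧ P ∣ g ∧ ¬ P.natDegree ∣ g.natDegree := by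
  by_contra! H
  have h0 := hg.ne_zero
  have hfin := finite_quotient_span_singleton h0
  refine hgC ⟨hfin, ?_, ?_, ?_⟩
  · rwa [Ideal.Quotient.nontrivial_iff, Ne, Ideal.span_singleton_eq_top]
  · rw [← Ideal.Quotient.maximal_ideal_iff_isField_quotient]
    intro hm
    have := hm.isPrime
    exact hirr ((Ideal.span_singleton_prime h0).1 this).irreducible
  · intro a
    obtain ⟨a, rfl⟩ := Ideal.Quotient.mk_surjective a
    rw [natCard_quotient_span_singleton h0, ← map_pow, ← sub_eq_zero, ← map_sub,
      Ideal.Quotient.eq_zero_iff_dvd]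
    set x := a ^ Nat.card F ^ g.natDegree - a
    have hrad : (Ideal.span {g}).IsRadical := by
      rw [← isRadical_iff_span_singleton]; exact hg.isRadical
    -- As `g` is square-free, `(g)` is the intersection of the primes containing it, so the identity
    -- can be checked modulo each.
    rw [← Ideal.mem_span_singleton, ← hrad.radical, Ideal.radical_eq_sInf, Submodule.mem_sInf]
    rintro J ⟨hgJ, hJ⟩
    obtain ⟨p, rfl⟩ := (IsPrincipalIdealRing.principal J).principal
    rw [Ideal.submodule_span_eq] at *
    rw [Ideal.span_singleton_le_span_singleton] at hgJ
    have hp0 : p ≠ 0 := ne_zero_of_dvd_ne_zero h0 hgJ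
    have hp := ((Ideal.span_singleton_prime hp0).1 hJ).irreducible
    classical
    obtain ⟨k, hk⟩ := H (normalize p) (monic_normalize hp0) ((associated_normalize p).irreducible hp)
      ((normalize_associated p).dvd.trans hgJ)
    rw [natDegree_eq_of_degree_eq degree_normalize] at hk
    have hmax : (Ideal.span {p}).IsMaximal := PrincipalIdealRing.isMaximal_of_irreducible hp
    let _ := Ideal.Quotient.field (Ideal.span {p})
    have := finite_quotient_span_singleton hp0
    let _ := Fintype.ofFinite (F[X] ⧸ Ideal.span {p})
    rw [← Ideal.Quotient.eq_zero_iff_mem, map_sub, sub_eq_zero, map_pow, hk, pow_mul,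
      ← natCard_quotient_span_singleton hp0, Nat.card_eq_fintype_card, FiniteField.pow_card_pow]

/-- An element of order `n` in `Eˣ` makes the `n`-th power map non-injective, hence non-surjective
by finiteness. -/
theorem exists_not_isPow_of_prime_dvd_card_sub_one {E : Type*} [Field E] [Finite E] {n : ℕ}
    (hn : n.Prime) (hdvd : n ∣ Nat.card E - 1) : ∃ c : E, ∀ b : E, b ^ n ≠ c := by
  by_contra! H
  have hinj : Function.Injective fun b : E ↦ b ^ n := Finite.injective_iff_surjective.2 H
  have : Fact n.Prime := ⟨hn⟩
  obtain ⟨u, hu⟩ := exists_prime_orderOf_dvd_card' (G := Eˣ) n (by rwa [Nat.card_units])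
  have h1 : u = 1 := Units.ext (hinj (by
    have h := congrArg Units.val (pow_orderOf_eq_one u)
    rw [hu, Units.val_pow_eq_pow_val] at h
    simpa using h))
  rw [h1, orderOf_one] at hu
  exact hn.ne_one hu.symm

theorem exists_isPrimitiveRoot_of_dvd_card_sub_one {F : Type*} [Field F] [Finite F] {n : ℕ}
    (hn : n.Prime) (hdvd : n ∣ Nat.card F - 1) : ∃ ζ : F, IsPrimitiveRoot ζ n := by
  have : Fact n.Prime := ⟨hn⟩
  obtain ⟨u, hu⟩ := exists_prime_orderOf_dvd_card' (G := Fˣ) n (by rwa [Nat.card_units])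
  exact ⟨u, IsPrimitiveRoot.coe_units_iff.2 (hu ▸ IsPrimitiveRoot.orderOf u)⟩

theorem exists_isCoprime_not_isPow {F : Type*} [Field F] [Finite F] {g P : F[X]}
    (hg : Squarefree g) (hP : Irreducible P) (hPg : P ∣ g) {n : ℕ}
    (hn : n.Prime) (hdvd : n ∣ Nat.card F - 1) :
    ∃ c : F[X], IsCoprime c g ∧ ∀ b : F[X] ⧸ Ideal.span {P}, b ^ n ≠ Ideal.Quotient.mk _ c := by
  have hmax : (Ideal.span {P}).IsMaximal := PrincipalIdealRing.isMaximal_of_irreducible hP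
  let _ := Ideal.Quotient.field (Ideal.span {P})
  have := finite_quotient_span_singleton hP.ne_zero
  obtain ⟨c, hc⟩ := exists_not_isPow_of_prime_dvd_card_sub_one (E := F[X] ⧸ Ideal.span {P}) hn (by
    rw [natCard_quotient_span_singleton hP.ne_zero]
    exact hdvd.trans (by simpa using Nat.sub_dvd_pow_sub_pow (Nat.card F) 1 P.natDegree))
  obtain ⟨c, rfl⟩ := Ideal.Quotient.mk_surjective c
  obtain ⟨h, rfl⟩ := hPg
  have hcop : IsCoprime P h := by
    rw [hP.coprime_iff_not_dvd]
    rintro ⟨h', rfl⟩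
    exact hP.not_isUnit (hg P ⟨h', by ring⟩)
  obtain ⟨u, v, huv⟩ := id hcop
  have hPc : IsCoprime P c := by
    rw [hP.coprime_iff_not_dvd, ← Ideal.Quotient.eq_zero_iff_dvd]
    intro h0
    exact hc 0 (by rw [h0, zero_pow hn.ne_zero])
  -- Chinese remaindering: since `u * P + v * h = 1`, this is `c` modulo `P` and `1` modulo the
  -- cofactor `h`.
  refine ⟨c + u * P * (1 - c), IsCoprime.mul_right ?_ ?_, fun b ↦ ?_⟩
  · have := hPc.symm.add_mul_left_left (u * (1 - c))
    rwa [← mul_assoc, mul_comm P u] at this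
  · have h1 : c + u * P * (1 - c) = 1 + h * (- v * (1 - c)) := by linear_combination (1 - c) * huv
    rw [h1]
    exact isCoprime_one_left.add_mul_left_left _
  · have : Ideal.Quotient.mk (Ideal.span {P}) (c + u * P * (1 - c)) = Ideal.Quotient.mk _ c := by
      rw [Ideal.Quotient.mk_eq_mk_iff_sub_mem, Ideal.mem_span_singleton]
      exact ⟨u * (1 - c), by ring⟩
    rw [this]; exact hc b

/-- Modulo `n`-th powers, a polynomial exactly divisible by `p` is not a power of a polynomial
prime to `p`. -/
theorem RatFunc.not_dvd_of_eq_pow_mul_pow {F : Type*} [Field F] {n i : ℕ} (hn : 1 < n)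
    {p Q Q' : F[X]} (hp : Irreducible p) (hQ : ¬ p ∣ Q) (hQ' : p ∣ Q') (hQ2 : ¬ p ^ 2 ∣ Q')
    {r : RatFunc F} : algebraMap F[X] (RatFunc F) Q' ≠ algebraMap F[X] (RatFunc F) Q ^ i * r ^ n := by
  intro h
  have hpp := hp.prime
  have hQ0' : Q' ≠ 0 := by rintro rfl; simp at hQ2
  have hQ0 : Q ≠ 0 := by rintro rfl; simp at hQ
  have hinj := IsFractionRing.injective F[X] (RatFunc F)
  obtain ⟨a, b, hb, rfl⟩ := IsFractionRing.div_surjective (A := F[X]) r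
  have hb0 : b ≠ 0 := nonZeroDivisors.ne_zero hb
  have hb' : algebraMap F[X] (RatFunc F) b ≠ 0 := by
    rwa [Ne, map_eq_zero_iff _ hinj]
  have key : Q' * b ^ n = Q ^ i * a ^ n := by
    apply hinj
    rw [map_mul, map_mul, map_pow, map_pow, map_pow, h, mul_assoc, ← mul_pow,
      div_mul_cancel₀ _ hb']
  have ha0 : a ≠ 0 := by
    rintro rfl
    rw [zero_pow (by omega), mul_zero] at key
    exact mul_ne_zero hQ0' (pow_ne_zero _ hb0) key
  have e1 : emultiplicity p Q' = 1 := by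
    have := (emultiplicity_eq_coe (a := p) (b := Q') (n := 1)).2 ⟨by simpa using hQ', hQ2⟩
    exact_mod_cast this
  have fa := (FiniteMultiplicity.of_prime_left hpp ha0).emultiplicity_eq_multiplicity
  have fb := (FiniteMultiplicity.of_prime_left hpp hb0).emultiplicity_eq_multiplicity
  -- Valuations at `p` give `1 + n * v(b) = n * v(a)`, impossible for `n > 1`.
  have := congrArg (emultiplicity p) key
  rw [emultiplicity_mul hpp, emultiplicity_mul hpp, emultiplicity_pow hpp, emultiplicity_pow hpp,
    emultiplicity_pow hpp, e1, emultiplicity_eq_zero.2 hQ, fa, fb, mul_zero, zero_add] at this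
  norm_cast at this
  have h1 : n ∣ 1 := (Nat.dvd_add_left (dvd_mul_right n _)).1 (this ▸ dvd_mul_right n _)
  exact hn.ne' (Nat.dvd_one.1 h1)

/-! ### Inertness by counting, discriminants, and divisibility of orders -/

/-- If `S` is free of rank `n` over `R`, then `S / aS` has `|R / a| ^ n` elements. -/
theorem natCard_quotient_span_algebraMap {R S : Type*} [CommRing R] [Nontrivial R] [CommRing S]
    [Algebra R S] [Module.Free R S] [Module.Finite R S] (a : R) :
    Nat.card (S ⧸ Ideal.span {algebraMap R S a}) =
      Nat.card (R ⧸ Ideal.span {a}) ^ Module.finrank R S := by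
  let b := Module.finBasis R S
  let f : S →ₗ[R] (Fin (Module.finrank R S) → R ⧸ Ideal.span {a}) :=
    (LinearMap.pi fun i ↦ (Submodule.mkQ (Ideal.span {a})) ∘ₗ LinearMap.proj i) ∘ₗ
      b.equivFun.toLinearMap
  have hf : Function.Surjective f := by
    intro y
    choose z hz using fun i ↦ Ideal.Quotient.mk_surjective (y i)
    refine ⟨b.equivFun.symm z, ?_⟩
    ext i
    change Ideal.Quotient.mk _ (b.equivFun (b.equivFun.symm z) i) = y i
    rw [LinearEquiv.apply_symm_apply, hz]
  have hker : f.toAddMonoidHom.ker = (Ideal.span {algebraMap R S a}).toAddSubgroup := by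
    ext x
    have h1 : x ∈ f.toAddMonoidHom.ker ↔ ∀ i, a ∣ b.equivFun x i := by
      rw [AddMonoidHom.mem_ker]
      change f x = 0 ↔ _
      rw [funext_iff]
      refine forall_congr' fun i ↦ ?_
      change Ideal.Quotient.mk _ (b.equivFun x i) = 0 ↔ _
      rw [Ideal.Quotient.eq_zero_iff_dvd]
    rw [h1]
    change _ ↔ x ∈ Ideal.span {algebraMap R S a}
    rw [Ideal.mem_span_singleton]
    constructor
    · intro h
      choose z hz using h
      refine ⟨b.equivFun.symm z, ?_⟩
      rw [← Algebra.smul_def]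
      apply b.equivFun.injective
      ext i
      rw [map_smul, LinearEquiv.apply_symm_apply, hz]; rfl
    · rintro ⟨y, rfl⟩ i
      rw [← Algebra.smul_def, map_smul]
      exact ⟨_, rfl⟩
  have e := QuotientAddGroup.quotientKerEquivOfSurjective f.toAddMonoidHom hf
  have h2 : Nat.card (S ⧸ f.toAddMonoidHom.ker) = Nat.card (S ⧸ Ideal.span {algebraMap R S a}) := by
    rw [hker]; rfl
  rw [← h2, Nat.card_congr e.toEquiv, Nat.card_fun, Nat.card_fin]

/-- A ring of cardinality `|k| ^ n` over a finite field `k`, in which some `c : k` that is not an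
`n`-th power in `k` becomes one, is a field. -/
theorem isField_of_pow_eq_of_not_isPow {k T : Type*} [Field k] [Finite k] [CommRing T]
    (i : k →+* T) {n : ℕ} (hn : n.Prime) (hcard : Nat.card T = Nat.card k ^ n) {c : k}
    (hc : ∀ b : k, b ^ n ≠ c) {x : T} (hx : x ^ n = i c) : IsField T := by
  have hk1 : 1 < Nat.card k := Finite.one_lt_card
  have hT1 : 1 < Nat.card T := hcard ▸ Nat.one_lt_pow hn.ne_zero hk1
  have hTfin : Finite T := Nat.finite_of_card_ne_zero (by omega)
  have : Nontrivial T := Finite.one_lt_card_iff_nontrivial.1 hT1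
  have hirr : Irreducible (X ^ n - C c) := X_pow_sub_C_irreducible_of_prime hn hc
  have : Fact (Irreducible (X ^ n - C c)) := ⟨hirr⟩
  let φ : AdjoinRoot (X ^ n - C c) →+* T :=
    AdjoinRoot.lift i x (by rw [eval₂_sub, eval₂_X_pow, eval₂_C, hx, sub_self])
  have hA : Nat.card (AdjoinRoot (X ^ n - C c)) = Nat.card k ^ n := by
    have : Module.Finite k (AdjoinRoot (X ^ n - C c)) :=
      (AdjoinRoot.powerBasis hirr.ne_zero).finite
    rw [Module.natCard_eq_pow_finrank (K := k), (AdjoinRoot.powerBasis hirr.ne_zero).finrank,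
      AdjoinRoot.powerBasis_dim, natDegree_X_pow_sub_C]
  have hbij : Function.Bijective φ :=
    Function.Injective.bijective_of_nat_card_le φ.injective (by rw [hcard, hA])
  exact (RingEquiv.ofBijective φ hbij).symm.toMulEquiv.isField (Field.toIsField _)

/-- If `c` is not an `n`-th power modulo the maximal ideal `(p)`, but is one in the extension `S`,
free of prime rank `n`, then `p` is inert in `S`. -/
theorem isMaximal_span_algebraMap_of_not_isPow {R S : Type*} [CommRing R] [CommRing S] [Algebra R S]
    [Module.Free R S] [Module.Finite R S] {p c : R} [hp : (Ideal.span {p}).IsMaximal]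
    [Finite (R ⧸ Ideal.span {p})] {n : ℕ} (hn : n.Prime) (hrank : Module.finrank R S = n)
    (hc : ∀ b : R ⧸ Ideal.span {p}, b ^ n ≠ Ideal.Quotient.mk _ c)
    {α : S} (hα : α ^ n = algebraMap R S c) : (Ideal.span {algebraMap R S p}).IsMaximal := by
  have : Nontrivial R := (Ideal.Quotient.mk (Ideal.span {p})).domain_nontrivial
  let _ := Ideal.Quotient.field (Ideal.span {p})
  let i : (R ⧸ Ideal.span {p}) →+* S ⧸ Ideal.span {algebraMap R S p} := Ideal.Quotient.lift _
    ((Ideal.Quotient.mk _).comp (algebraMap R S)) (fun a ha ↦ by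
      obtain ⟨d, rfl⟩ := Ideal.mem_span_singleton.1 ha
      rw [RingHom.comp_apply, map_mul, Ideal.Quotient.eq_zero_iff_dvd]
      exact dvd_mul_right _ _)
  rw [Ideal.Quotient.maximal_ideal_iff_isField_quotient]
  refine isField_of_pow_eq_of_not_isPow i hn ?_ hc (x := Ideal.Quotient.mk _ α) ?_
  · rw [natCard_quotient_span_algebraMap, hrank]
  · rw [← map_pow, hα]; rfl

/-- The discriminant is, up to sign, the norm of `n * α ^ (n - 1)`, the derivative of the minimal
polynomial at the generator `α`. The signs are left unspecified because only coprimality matters. -/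
theorem discr_powerBasis_of_minpoly_eq {k L : Type*} [Field k] [Field L] [Algebra k L]
    [Algebra.IsSeparable k L] (pb : PowerBasis k L) {n : ℕ} (hn : n ≠ 0) {a : k}
    (hmin : minpoly k pb.gen = X ^ n - C a) :
    ∃ i j : ℕ, Algebra.discr k pb.basis = (-1) ^ i * ((n : k) ^ n * ((-1) ^ j * a) ^ (n - 1)) := by
  have : FiniteDimensional k L := pb.finite
  have hdim : Module.finrank k L = n := by
    rw [pb.finrank, ← pb.natDegree_minpoly, hmin, natDegree_X_pow_sub_C]
  have hnorm : Algebra.norm k pb.gen = (-1) ^ (n + 1) * a := by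
    rw [Algebra.PowerBasis.norm_gen_eq_coeff_zero_minpoly, hmin, ← pb.finrank, hdim]
    simp [hn.symm, pow_succ]
  have haev : aeval pb.gen (derivative (X ^ n - C a)) = algebraMap k L n * pb.gen ^ (n - 1) := by
    rw [derivative_sub, derivative_X_pow, derivative_C, sub_zero, map_mul, map_pow, aeval_X, aeval_C]
  have h := Algebra.discr_powerBasis_eq_norm k pb
  rw [hmin, haev, map_mul, map_pow, hnorm, Algebra.norm_algebraMap, hdim] at h
  exact ⟨_, _, h⟩

theorem Nat.dvd_of_pow_sub_one_dvd_pow_sub_one {q a b : ℕ} (hq : 1 < q)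
    (h : q ^ a - 1 ∣ q ^ b - 1) : a ∣ b := by
  have h1 := Nat.pow_sub_one_gcd_pow_sub_one q a b
  rw [Nat.gcd_eq_left h] at h1
  have h2 : q ^ a = q ^ a.gcd b := by
    have := Nat.one_le_pow a q (by omega)
    have := Nat.one_le_pow (a.gcd b) q (by omega)
    omega
  rw [Nat.pow_right_injective hq h2]
  exact Nat.gcd_dvd_right a b

theorem natCard_sub_one_dvd_of_forall_pow_eq {E : Type*} [Field E] [Finite E] {N : ℕ} (hN : N ≠ 0)
    (h : ∀ x : E, x ^ N = x) : Nat.card E - 1 ∣ N - 1 := by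
  obtain ⟨u, hu⟩ := IsCyclic.exists_generator (α := Eˣ)
  rw [← Nat.card_units, ← orderOf_eq_card_of_forall_mem_zpowers hu, orderOf_dvd_iff_pow_eq_one]
  apply mul_right_cancel (b := u)
  rw [← pow_succ, Nat.sub_add_cancel (Nat.one_le_iff_ne_zero.2 hN), one_mul]
  exact Units.ext (by rw [Units.val_pow_eq_pow_val, h])

/-! ### Rings of integers of function fields -/

section FunctionField

theorem mem_discriminantIdeal_of_powerBasis {F K : Type*} [Field F] [Field K]
    [Algebra F[X] K] [Algebra (RatFunc F) K] (pb : PowerBasis (RatFunc F) K)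
    (hint : IsIntegral F[X] pb.gen) {d : F[X]}
    (hd : algebraMap F[X] (RatFunc F) d = Algebra.discr (RatFunc F) pb.basis) :
    d ∈ discriminantIdeal F K := by
  classical
  refine Ideal.subset_span ⟨pb.basis.reindex (finCongr pb.finrank.symm), fun i ↦ ?_, ?_⟩
  · rw [Module.Basis.reindex_apply, pb.basis_eq_pow]
    exact hint.pow _
  · rw [hd, Module.Basis.coe_reindex,
      ← Algebra.discr_reindex (RatFunc F) pb.basis (finCongr pb.finrank.symm)]

theorem isCoprime_discriminantIdeal {F K : Type*} [Field F] [Field K] [Algebra F[X] K]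
    [Algebra (RatFunc F) K] [IsScalarTower F[X] (RatFunc F) K] [Algebra.IsSeparable (RatFunc F) K]
    {n : ℕ} (hn : n ≠ 0) (hnF : (n : F) ≠ 0) {Q g : F[X]}
    (hQ : IsCoprime Q g) (pb : PowerBasis (RatFunc F) K)
    (hmin : minpoly (RatFunc F) pb.gen = X ^ n - C (algebraMap F[X] (RatFunc F) Q)) :
    IsCoprime (discriminantIdeal F K) (Ideal.span {g}) := by
  obtain ⟨i, j, hd⟩ := discr_powerBasis_of_minpoly_eq pb hn hmin
  have hint : IsIntegral F[X] pb.gen := by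
    refine IsIntegral.of_pow (Nat.pos_of_ne_zero hn) ?_
    have h := minpoly.aeval (RatFunc F) pb.gen
    rw [hmin, map_sub, map_pow, aeval_X, aeval_C, sub_eq_zero,
      ← IsScalarTower.algebraMap_apply] at h
    exact h ▸ isIntegral_algebraMap
  have hmem : (-1) ^ i * ((n : F[X]) ^ n * ((-1) ^ j * Q) ^ (n - 1)) ∈ discriminantIdeal F K :=
    mem_discriminantIdeal_of_powerBasis pb hint (by rw [hd]; simp)
  have hunit : ∀ m : ℕ, IsUnit ((-1 : F[X]) ^ m) := fun m ↦ isUnit_one.neg.pow m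
  have hnu : IsUnit (n : F[X]) := by
    rw [← C_eq_natCast]; exact (isUnit_C.2 (isUnit_iff_ne_zero.2 hnF))
  have hcop : IsCoprime ((-1) ^ i * ((n : F[X]) ^ n * ((-1) ^ j * Q) ^ (n - 1))) g := by
    rw [isCoprime_mul_unit_left_left (hunit i), isCoprime_mul_unit_left_left (hnu.pow n)]
    exact ((isCoprime_mul_unit_left_left (hunit j) Q g).2 hQ).pow_left
  rw [Ideal.isCoprime_iff_exists]
  obtain ⟨u, v, huv⟩ := hcop
  exact ⟨_, Ideal.mul_mem_left _ u hmem, _, Ideal.mul_mem_left _ v (Ideal.mem_span_singleton_self g),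
    huv⟩

theorem not_isCarmichaelIn_of_irreducible {F K : Type*} [Field F] [Field K] [Algebra F[X] K]
    {g P : F[X]} (hg : Irreducible g) (hP : Irreducible P)
    (hPg : P ∣ g)
    (hmax : (Ideal.span {algebraMap F[X] (FunctionField.ringOfIntegers F K) P}).IsMaximal) :
    ¬ IsCarmichaelIn K g := by
  rintro ⟨-, -, hfield, -⟩
  have ha : Associated P g := hP.associated_of_dvd hg hPg
  have : Ideal.span {algebraMap F[X] (FunctionField.ringOfIntegers F K) P} =
      Ideal.span {algebraMap F[X] (FunctionField.ringOfIntegers F K) g} :=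
    Ideal.span_singleton_eq_span_singleton.2 (ha.map _)
  rw [this] at hmax
  exact hfield ((Ideal.Quotient.maximal_ideal_iff_isField_quotient _).1 hmax)

theorem not_isCarmichaelIn_of_isUnit {F K : Type*} [Field F] [Field K] [Algebra F[X] K] {g : F[X]}
    (hg : IsUnit g) : ¬ IsCarmichaelIn K g := by
  rintro ⟨-, hnt, -, -⟩
  rw [Ideal.Quotient.nontrivial_iff] at hnt
  exact hnt (Ideal.span_singleton_eq_top.2 (hg.map _))

variable {F K : Type*} [Field F] [Field K] [Algebra F[X] K] [Algebra (RatFunc F) K]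
  [IsScalarTower F[X] (RatFunc F) K] [FiniteDimensional (RatFunc F) K]
  [Algebra.IsSeparable (RatFunc F) K]

theorem FunctionField.ringOfIntegers.moduleFinite :
    Module.Finite F[X] (FunctionField.ringOfIntegers F K) :=
  Module.IsNoetherian.finite _ _

theorem FunctionField.ringOfIntegers.moduleFree :
    Module.Free F[X] (FunctionField.ringOfIntegers F K) :=
  have : Module.IsTorsionFree F[X] K := .trans_faithfulSMul F[X] (RatFunc F) K
  IsIntegralClosure.module_free F[X] (RatFunc F) K _

theorem FunctionField.ringOfIntegers.finrank_eq :
    Module.finrank F[X] (FunctionField.ringOfIntegers F K) = Module.finrank (RatFunc F) K :=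
  have : Module.IsTorsionFree F[X] K := .trans_faithfulSMul F[X] (RatFunc F) K
  IsIntegralClosure.rank F[X] (RatFunc F) K _

theorem FunctionField.ringOfIntegers.natCard_quotient_span {f : F[X]} (hf : f ≠ 0) :
    Nat.card (FunctionField.ringOfIntegers F K ⧸
      Ideal.span {algebraMap F[X] (FunctionField.ringOfIntegers F K) f}) =
      Nat.card F ^ (f.natDegree * Module.finrank (RatFunc F) K) := by
  have := FunctionField.ringOfIntegers.moduleFinite (F := F) (K := K)
  have := FunctionField.ringOfIntegers.moduleFree (F := F) (K := K)
  rw [natCard_quotient_span_algebraMap, natCard_quotient_span_singleton hf,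
    FunctionField.ringOfIntegers.finrank_eq, pow_mul]

/-- With `d = [K : F(t)]`, the Carmichael identity descends to the residue field at `P`, whose
cyclic unit group forces `q ^ (d deg P) - 1 ∣ q ^ (d deg g) - 1`, hence `deg P ∣ deg g`. -/
theorem not_isCarmichaelIn_of_not_natDegree_dvd [Finite F] {g P : F[X]} (hg : g ≠ 0) (hP : P ∣ g)
    (hmax : (Ideal.span {algebraMap F[X] (FunctionField.ringOfIntegers F K) P}).IsMaximal)
    (hdeg : ¬ P.natDegree ∣ g.natDegree) : ¬ IsCarmichaelIn K g := by
  rintro ⟨-, -, -, hpow⟩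
  rw [FunctionField.ringOfIntegers.natCard_quotient_span hg] at hpow
  let _ := Ideal.Quotient.field
    (Ideal.span {algebraMap F[X] (FunctionField.ringOfIntegers F K) P})
  have hq : 1 < Nat.card F := Finite.one_lt_card
  have hcard := FunctionField.ringOfIntegers.natCard_quotient_span (K := K)
    (ne_zero_of_dvd_ne_zero hg hP)
  have : Finite (FunctionField.ringOfIntegers F K ⧸
      Ideal.span {algebraMap F[X] (FunctionField.ringOfIntegers F K) P}) :=
    Nat.finite_of_card_ne_zero (hcard ▸ pow_ne_zero _ (by omega))
  have h := natCard_sub_one_dvd_of_forall_pow_eq (pow_ne_zero _ (by omega)) (fun x ↦ by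
    obtain ⟨x, rfl⟩ := Ideal.Quotient.mk_surjective x
    have h := hpow (Ideal.Quotient.mk _ x)
    rw [← map_pow, Ideal.Quotient.mk_eq_mk_iff_sub_mem, Ideal.mem_span_singleton] at h
    rw [← map_pow, Ideal.Quotient.mk_eq_mk_iff_sub_mem, Ideal.mem_span_singleton]
    exact (_root_.map_dvd _ hP).trans h :
    ∀ x : FunctionField.ringOfIntegers F K ⧸
      Ideal.span {algebraMap F[X] (FunctionField.ringOfIntegers F K) P},
        x ^ Nat.card F ^ (g.natDegree * Module.finrank (RatFunc F) K) = x)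
  rw [hcard] at h
  exact hdeg (Nat.dvd_of_mul_dvd_mul_right Module.finrank_pos
    (Nat.dvd_of_pow_sub_one_dvd_pow_sub_one hq h))

theorem isMaximal_span_of_not_isPow [Finite F] {P Q : F[X]} (hP : Irreducible P) {n : ℕ}
    (hn : n.Prime) (hrank : Module.finrank (RatFunc F) K = n)
    (hQ : ∀ b : F[X] ⧸ Ideal.span {P}, b ^ n ≠ Ideal.Quotient.mk _ Q)
    {α : K} (hα : α ^ n = algebraMap F[X] K Q) :
    (Ideal.span {algebraMap F[X] (FunctionField.ringOfIntegers F K) P}).IsMaximal := by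
  have := FunctionField.ringOfIntegers.moduleFinite (F := F) (K := K)
  have := FunctionField.ringOfIntegers.moduleFree (F := F) (K := K)
  have : (Ideal.span {P}).IsMaximal := PrincipalIdealRing.isMaximal_of_irreducible hP
  have := finite_quotient_span_singleton hP.ne_zero
  have hint : IsIntegral F[X] α := IsIntegral.of_pow hn.pos (hα ▸ isIntegral_algebraMap)
  refine isMaximal_span_algebraMap_of_not_isPow hn
    (FunctionField.ringOfIntegers.finrank_eq.trans hrank) hQ
    (α := (⟨α, hint⟩ : FunctionField.ringOfIntegers F K)) ?_
  exact Subtype.ext hα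

end FunctionField

theorem natCast_ne_zero_of_dvd_natCard_sub_one {F : Type*} [Field F] [Finite F] {n : ℕ}
    (hdvd : n ∣ Nat.card F - 1) : (n : F) ≠ 0 := by
  intro h
  obtain ⟨m, hm⟩ := hdvd
  have h1 : Nat.card F = n * m + 1 := by
    have : 1 < Nat.card F := Finite.one_lt_card
    omega
  let _ := Fintype.ofFinite F
  have h2 : ((Nat.card F : ℕ) : F) = 0 := by rw [Nat.card_eq_fintype_card, Nat.cast_card_eq_zero]
  rw [h1] at h2
  simp [h] at h2

theorem RatFunc.pow_ne_algebraMap_of_dvd {F : Type*} [Field F] {n : ℕ} (hn : 1 < n) {p Q : F[X]}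
    (hp : Irreducible p) (hpQ : p ∣ Q) (hpQ2 : ¬ p ^ 2 ∣ Q) (r : RatFunc F) :
    r ^ n ≠ algebraMap F[X] (RatFunc F) Q := by
  intro h
  have h1 : ¬ p ∣ 1 := fun h ↦ hp.not_isUnit (isUnit_of_dvd_one h)
  exact RatFunc.not_dvd_of_eq_pow_mul_pow (i := 0) hn hp h1 hpQ hpQ2 (r := r) (by rw [h]; simp)

/-! ### Infinite families of Kummer extensions -/

open IntermediateField

section

variable {F : Type*} [Field F] {n : ℕ}

/-- Equal fields would give `Q p' = (Q p) ^ i * r ^ n`, but `p'` divides `Q p'` exactly once and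
does not divide `Q p`. -/
theorem injOn_adjoin_of_pow_eq (hn : n.Prime) {ζ : F} (hζ : IsPrimitiveRoot ζ n)
    {L : Type*} [Field L] [Algebra (RatFunc F) L] {S : Set F[X]} {Q : F[X] → F[X]} {α : F[X] → L}
    (hα : ∀ p, α p ^ n = algebraMap (RatFunc F) L (algebraMap F[X] (RatFunc F) (Q p)))
    (hS : ∀ p ∈ S, Irreducible p ∧ p ∣ Q p ∧ ¬ p ^ 2 ∣ Q p)
    (hS' : ∀ p ∈ S, ∀ p' ∈ S, p' ∣ Q p → p = p') :
    Set.InjOn (fun p ↦ (RatFunc F)⟮α p⟯) S := by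
  intro p hp p' hp' h
  by_contra hne
  have hζ' := hζ.map_of_injective (algebraMap F (RatFunc F)).injective
  obtain ⟨i, r, hr⟩ := exists_eq_pow_mul_pow_of_adjoin_eq hn hζ'
    (RatFunc.pow_ne_algebraMap_of_dvd hn.one_lt (hS p hp).1 (hS p hp).2.1 (hS p hp).2.2)
    (hα p) (hα p') ((congrArg (α p' ∈ ·) h).mpr (mem_adjoin_simple_self _ _))
  exact RatFunc.not_dvd_of_eq_pow_mul_pow hn.one_lt (hS p' hp').1
    (fun hd ↦ hne (hS' p hp p' hp' hd)) (hS p' hp').2.1 (hS p' hp').2.2 hr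

/-- Here `good` abstracts the local condition on the radicand: a non-residue modulo `P` when
inertness is wanted, no condition when `g` is a unit. -/
theorem infinite_of_forall_adjoin_mem (hn : n.Prime) {ζ : F} (hζ : IsPrimitiveRoot ζ n)
    {g c : F[X]} (hg : g ≠ 0) (hc : c ≠ 0) (hcg : IsCoprime c g) {good : F[X] → Prop}
    (hgood : ∀ p : F[X], Irreducible p → ¬ p ∣ g → good p ∨ good (p * c))
    {T : Set (IntermediateField (RatFunc F) (AlgebraicClosure (RatFunc F)))}
    (hT : ∀ (Q : F[X]) (α : AlgebraicClosure (RatFunc F)),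
      α ^ n = algebraMap (RatFunc F) _ (algebraMap F[X] (RatFunc F) Q) → IsCoprime Q g →
      (∀ r : RatFunc F, r ^ n ≠ algebraMap F[X] (RatFunc F) Q) → good Q → (RatFunc F)⟮α⟯ ∈ T) :
    T.Infinite := by
  classical
  -- Avoiding `c` makes `p` divide its own radicand exactly once and no other; avoiding `g` keeps
  -- the radicand prime to `g`.
  set S : Set F[X] := {p | p.Monic ∧ Irreducible p ∧ ¬ p ∣ c * g}
  have hSinf : S.Infinite := infinite_setOf_monic_irreducible_not_dvd (mul_ne_zero hc hg)
  let u : F[X] → F[X] := fun p ↦ if good p then 1 else c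
  have hu : ∀ p, u p ∣ c := fun p ↦ by
    by_cases h : good p <;> simp [u, h]
  choose α hα using fun p : F[X] ↦ IsAlgClosed.exists_pow_nat_eq
    (algebraMap (RatFunc F) (AlgebraicClosure (RatFunc F))
      (algebraMap F[X] (RatFunc F) (p * u p))) hn.pos
  have hpu : ∀ p ∈ S, ∀ q, ¬ p ∣ u q := fun p hp q h ↦
    hp.2.2 ((h.trans (hu q)).mul_right g)
  have hS : ∀ p ∈ S, Irreducible p ∧ p ∣ p * u p ∧ ¬ p ^ 2 ∣ p * u p := fun p hp ↦
    ⟨hp.2.1, dvd_mul_right _ _, fun h ↦ hpu p hp p <| by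
      rw [sq] at h
      exact (mul_dvd_mul_iff_left hp.2.1.ne_zero).1 h⟩
  refine Set.infinite_of_injOn_mapsTo (injOn_adjoin_of_pow_eq hn hζ hα hS ?_) ?_ hSinf
  · intro p hp p' hp' hd
    rcases hp'.2.1.prime.dvd_or_dvd hd with h | h
    · exact (eq_of_monic_of_associated hp'.1 hp.1 (hp'.2.1.associated_of_dvd hp.2.1 h)).symm
    · exact absurd h (hpu p' hp' p)
  · intro p hp
    have hpg : ¬ p ∣ g := fun h ↦ hp.2.2 (h.mul_left c)
    refine hT _ _ (hα p) ?_
      (RatFunc.pow_ne_algebraMap_of_dvd hn.one_lt (hS p hp).1 (hS p hp).2.1 (hS p hp).2.2) ?_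
    · exact ((hp.2.1.coprime_iff_not_dvd).2 hpg).mul_left (hcg.of_isCoprime_of_dvd_left (hu p))
    · by_cases h : good p
      · simp [u, h]
      · simpa [u, h] using (hgood p hp.2.1 hpg).resolve_left h

variable [Finite F]

theorem adjoin_mem_nonCarmichaelKummerExtensions (hn : n.Prime) (hdvd : n ∣ Nat.card F - 1)
    {g Q : F[X]} {α : AlgebraicClosure (RatFunc F)}
    (hα : α ^ n = algebraMap (RatFunc F) _ (algebraMap F[X] (RatFunc F) Q)) (hQg : IsCoprime Q g)
    (hQ : ∀ r : RatFunc F, r ^ n ≠ algebraMap F[X] (RatFunc F) Q)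
    (hC : ¬ IsCarmichaelIn (RatFunc F)⟮α⟯ g) :
    (RatFunc F)⟮α⟯ ∈ nonCarmichaelKummerExtensions g n := by
  obtain ⟨ζ, hζ⟩ := exists_isPrimitiveRoot_of_dvd_card_sub_one hn hdvd
  have hcyc := isGalois_isCyclic_finrank_adjoin_of_pow_eq hn
    (hζ.map_of_injective (algebraMap F (RatFunc F)).injective) hQ hα
  refine ⟨hcyc, ⟨Q, α, ?_, rfl⟩, ?_, hC⟩
  · rw [hα, ← IsScalarTower.algebraMap_apply]
  · have := hcyc.1
    have : FiniteDimensional (RatFunc F) (RatFunc F)⟮α⟯ :=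
      .of_finrank_pos (hcyc.2.2 ▸ hn.pos)
    have hint : IsIntegral (RatFunc F) α := Algebra.IsIntegral.isIntegral α
    refine isCoprime_discriminantIdeal hn.ne_zero (natCast_ne_zero_of_dvd_natCard_sub_one hdvd)
      hQg (adjoin.powerBasis hint) ?_
    rw [adjoin.powerBasis_gen, minpoly_gen]
    exact (minpoly.eq_of_irreducible_of_monic (X_pow_sub_C_irreducible_of_prime hn hQ)
      (by simp [hα]) (monic_X_pow_sub_C _ hn.ne_zero)).symm

theorem isMaximal_span_adjoin_of_not_isPow (hn : n.Prime) (hdvd : n ∣ Nat.card F - 1)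
    {P Q : F[X]} (hP : Irreducible P) {α : AlgebraicClosure (RatFunc F)}
    (hα : α ^ n = algebraMap (RatFunc F) _ (algebraMap F[X] (RatFunc F) Q))
    (hQ : ∀ r : RatFunc F, r ^ n ≠ algebraMap F[X] (RatFunc F) Q)
    (hQP : ∀ b : F[X] ⧸ Ideal.span {P}, b ^ n ≠ Ideal.Quotient.mk _ Q) :
    (Ideal.span {algebraMap F[X]
      (FunctionField.ringOfIntegers F (RatFunc F)⟮α⟯) P}).IsMaximal := by
  obtain ⟨ζ, hζ⟩ := exists_isPrimitiveRoot_of_dvd_card_sub_one hn hdvd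
  obtain ⟨hgal, -, hfin⟩ := isGalois_isCyclic_finrank_adjoin_of_pow_eq hn
    (hζ.map_of_injective (algebraMap F (RatFunc F)).injective) hQ hα
  have : FiniteDimensional (RatFunc F) (RatFunc F)⟮α⟯ := .of_finrank_pos (hfin ▸ hn.pos)
  refine isMaximal_span_of_not_isPow hP hn hfin hQP (α := AdjoinSimple.gen (RatFunc F) α) ?_
  rw [IsScalarTower.algebraMap_apply F[X] (RatFunc F)]
  exact Subtype.ext (by simpa using hα)

theorem infinite_nonCarmichaelKummerExtensions_inert (hn : n.Prime) (hdvd : n ∣ Nat.card F - 1)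
    {g P : F[X]} (hg : Squarefree g) (hP : Irreducible P) (hPg : P ∣ g)
    (hdeg : Irreducible g ∨ ¬ P.natDegree ∣ g.natDegree) :
    {K ∈ nonCarmichaelKummerExtensions g n | IsInertIn K P}.Infinite := by
  obtain ⟨ζ, hζ⟩ := exists_isPrimitiveRoot_of_dvd_card_sub_one hn hdvd
  obtain ⟨c, hcg, hcP⟩ := exists_isCoprime_not_isPow hg hP hPg hn hdvd
  have hmax : (Ideal.span {P}).IsMaximal := PrincipalIdealRing.isMaximal_of_irreducible hP
  let _ := Ideal.Quotient.field (Ideal.span {P})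
  refine infinite_of_forall_adjoin_mem hn hζ hg.ne_zero ?_ hcg
    (good := fun Q ↦ ∀ b : F[X] ⧸ Ideal.span {P}, b ^ n ≠ Ideal.Quotient.mk _ Q) ?_ ?_
  · rintro rfl
    exact hcP 0 (by rw [zero_pow hn.ne_zero, map_zero])
  · intro p hp hpg
    by_contra! h
    obtain ⟨⟨b, hb⟩, d, hd⟩ := h
    have hp0 : Ideal.Quotient.mk (Ideal.span {P}) p ≠ 0 := by
      rw [Ne, Ideal.Quotient.eq_zero_iff_dvd]
      exact fun h ↦ hpg ((hP.associated_of_dvd hp h).dvd'.trans hPg)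
    -- If both `p = b ^ n` and `p * c = d ^ n` modulo `P`, then `c = (d / b) ^ n`, contrary to its
    -- choice.
    apply hcP (d / b)
    rw [div_pow, hd, hb, map_mul, mul_div_cancel_left₀ _ hp0]
  · intro Q α hα hQg hQ hQP
    have hmaxP := isMaximal_span_adjoin_of_not_isPow hn hdvd hP hα hQ hQP
    obtain ⟨hgal, -, hfin⟩ := isGalois_isCyclic_finrank_adjoin_of_pow_eq hn
      (hζ.map_of_injective (algebraMap F (RatFunc F)).injective) hQ hα
    have : FiniteDimensional (RatFunc F) (RatFunc F)⟮α⟯ := .of_finrank_pos (hfin ▸ hn.pos)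
    refine ⟨adjoin_mem_nonCarmichaelKummerExtensions hn hdvd hα hQg hQ ?_, hmaxP.isPrime⟩
    rcases hdeg with h | h
    · exact not_isCarmichaelIn_of_irreducible h hP hPg hmaxP
    · exact not_isCarmichaelIn_of_not_natDegree_dvd hg.ne_zero hPg hmaxP h

end

theorem theorem5p6 {F : Type*} [Field F] [Finite F] (g : F[X]) (hg : Squarefree g)
    (hgC : ¬ IsCarmichaelElement g) (ℓ : ℕ) (hℓ : ℓ.Prime) (hdvd : ℓ ∣ Nat.card F - 1) :
    (nonCarmichaelKummerExtensions g ℓ).Infinite ∧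
      (¬ IsUnit g → ∃ P : F[X], P.Monic ∧ Irreducible P ∧ P ∣ g ∧
        (Irreducible g ∨ ¬ P.natDegree ∣ g.natDegree) ∧
        {K ∈ nonCarmichaelKummerExtensions g ℓ | IsInertIn K P}.Infinite) := by
  have hinert : ¬ IsUnit g → ∃ P : F[X], P.Monic ∧ Irreducible P ∧ P ∣ g ∧
      (Irreducible g ∨ ¬ P.natDegree ∣ g.natDegree) ∧
      {K ∈ nonCarmichaelKummerExtensions g ℓ | IsInertIn K P}.Infinite := by
    intro hu
    obtain ⟨P, hPm, hP, hPg, hdeg⟩ : ∃ P : F[X], P.Monic ∧ Irreducible P ∧ P ∣ g ∧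
        (Irreducible g ∨ ¬ P.natDegree ∣ g.natDegree) := by
      by_cases hirr : Irreducible g
      · obtain ⟨P, hPm, hP, hPg⟩ := exists_monic_irreducible_dvd hu hg.ne_zero
        exact ⟨P, hPm, hP, hPg, .inl hirr⟩
      · obtain ⟨P, hPm, hP, hPg, hd⟩ := exists_irreducible_dvd_not_natDegree_dvd hg hgC hu hirr
        exact ⟨P, hPm, hP, hPg, .inr hd⟩
    exact ⟨P, hPm, hP, hPg, hdeg,
      infinite_nonCarmichaelKummerExtensions_inert hℓ hdvd hg hP hPg hdeg⟩
  refine ⟨?_, hinert⟩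
  -- A unit has no prime factor to make inert, but its quotient ring is zero, so it is never
  -- Carmichael.
  by_cases hu : IsUnit g
  · obtain ⟨ζ, hζ⟩ := exists_isPrimitiveRoot_of_dvd_card_sub_one hℓ hdvd
    exact infinite_of_forall_adjoin_mem hℓ hζ hg.ne_zero one_ne_zero isCoprime_one_left
      (good := fun _ ↦ True) (fun _ _ _ ↦ .inl trivial) fun Q α hα hQg hQ _ ↦
        adjoin_mem_nonCarmichaelKummerExtensions hℓ hdvd hα hQg hQ
          (not_isCarmichaelIn_of_isUnit hu)
  · obtain ⟨P, -, -, -, -, hinf⟩ := hinert hu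
    exact hinf.mono fun K hK ↦ hK.1
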